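/- Let $n\ge 0$ and let $Y(n)$ be the Yangian of $\mathfrak{gl}_n(\mathbb C)$: the associative unital $\mathbb C$-algebra generated by $t_{ij}^{(r)}$ ($1\le i,j\le n$, $r\ge 1$) with the defining relation $R(u-v)T_1(u)T_2(v)=T_2(v)T_1(u)R(u-v)$, where $R(u)=1-P/u$, $P=\sum_{i,j}E_{ij}\otimes E_{ji}$, $T(u)=(t_{ij}(u))$ and $t_{ij}(u)=\delta_{ij}+\sum_{r\ge1}t_{ij}^{(r)}u^{-r}$. Series in $Y(n)[[u^{-1}]]$ are regarded as operators of left multiplication on $Y(n)[[u^{-1}]]$, and $\tau^{\pm1}$ denotes the operator $g(u)\mapsto g(u\pm1)$. For an $n\times n$ matrix $X$ over an associative algebra $A$ put $X^{[k]}=X_1X_2\cdots X_k\in \mathrm{End}(\mathbb C^n)^{\otimes k}\otimes A$, where $X_s$ is $X$ acting in the $s$-th tensor factor, and let $X^k$ be the usual matrix power. Let $A_k=\frac1{k!}\sum_{\sigma\in\mathfrak S_k}\operatorname{sgn}(\sigma)\,\sigma$ and $S_k=\frac1{k!}\sum_{\sigma\in\mathfrak S_k}\sigma$ act on $(\mathbb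 C^n)^{\otimes k}$ by permuting the tensor factors. Define the operators $$e_k(u,\tau)=\operatorname{tr}\bigl(A_k\,(T(u)\tau^{-1})^{[k]}\bigr),\qquad h_k(u,\tau)=\operatorname{tr}\bigl(S_k\,(T(u)\tau)^{[k]}\bigr),\qquad p_k^{\pm}(u,\tau)=\operatorname{tr}\bigl((T(u)\tau^{\pm1})^{k}\bigr).$$ Then for every $k\ge 0$ $$e_k(u,\tau)=\sum_{\lambda}\frac{(-1)^{k-m}}{a_1a_2\cdots a_m}\,p^-_{\lambda_1}(u,\tau)\cdots p^-_{\lambda_m}(u,\tau),\qquad h_k(u,\tau)=\sum_{\lambda}\frac{1}{a_1a_2\cdots a_m}\,p^+_{\lambda_1}(u,\tau)\cdots p^+_{\lambda_m}(u,\tau),$$ where both sums run over all compositions $\lambda=(\lambda_1,\dots,\lambda_m)$ of $k$ (ordered tuples of positive integers with sum $k$; for $k=0$ only the empty one) and $a_i=\lambda_1+\cdots+\lambda_i$. -/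

import Mathlib

noncomputable section

namespace YangianGL

/-! ### The Yangian of `gl_n(ℂ)` -/

/-- `(i, j, k)` is the index of the generator `t_{ij}^{(k+1)}`, `k = 0, 1, 2, …`. -/
abbrev Gen (n : ℕ) : Type := Fin n × Fin n × ℕ

/-- The generating matrix `T(u)` over the free algebra. Series in `u⁻¹` are power series whose
variable stands for `u⁻¹`. The entries are
`t_{ij}(u) = δ_{ij} + t_{ij}^{(1)} u⁻¹ + t_{ij}^{(2)} u⁻² + …`. -/
def freeT (n : ℕ) : Matrix (Fin n) (Fin n) (PowerSeries (FreeAlgebra ℂ (Gen n))) :=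
  Matrix.of fun i j => PowerSeries.mk fun k =>
    match k with
    | 0 => if i = j then 1 else 0
    | r + 1 => FreeAlgebra.ι ℂ (i, j, r)

/-- Series in `u⁻¹` and `v⁻¹`: the outer power series variable is `u⁻¹`, the inner one `v⁻¹`. -/
abbrev Series₂ (A : Type) [Semiring A] : Type := PowerSeries (PowerSeries A)

/-- The series `u⁻¹`. -/
def uInv (A : Type) [Ring A] : Series₂ A := PowerSeries.X

/-- The series `v⁻¹`. -/
def vInv (A : Type) [Ring A] : Series₂ A := PowerSeries.C PowerSeries.X

/-- `M₁(u)`: the matrix `M(u)` acting in the first factor of `ℂⁿ ⊗ ℂⁿ`. -/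
def inFirst {n : ℕ} {A : Type} [Ring A] (M : Matrix (Fin n) (Fin n) (PowerSeries A)) :
    Matrix (Fin n × Fin n) (Fin n × Fin n) (Series₂ A) :=
  Matrix.of fun a b => if a.2 = b.2 then PowerSeries.map PowerSeries.C (M a.1 b.1) else 0

/-- `M₂(v)`: the matrix `M(v)` acting in the second factor of `ℂⁿ ⊗ ℂⁿ`. -/
def inSecond {n : ℕ} {A : Type} [Ring A] (M : Matrix (Fin n) (Fin n) (PowerSeries A)) :
    Matrix (Fin n × Fin n) (Fin n × Fin n) (Series₂ A) :=
  Matrix.of fun a b => if a.1 = b.1 then PowerSeries.C (M a.2 b.2) else 0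

/-- The flip `P = ∑ E_{ij} ⊗ E_{ji}` of `ℂⁿ ⊗ ℂⁿ`. -/
def flip (n : ℕ) (A : Type) [Ring A] :
    Matrix (Fin n × Fin n) (Fin n × Fin n) (Series₂ A) :=
  Matrix.of fun a b => if a.1 = b.2 ∧ a.2 = b.1 then 1 else 0

/-- The Yang matrix `R(u - v) = 1 - P / (u - v)`, cleared of its denominator and written in
`u⁻¹, v⁻¹`: this is `u⁻¹ v⁻¹ (u - v) R(u - v) = (v⁻¹ - u⁻¹) - u⁻¹ v⁻¹ P`. -/
def clearedR (n : ℕ) (A : Type) [Ring A] :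
    Matrix (Fin n × Fin n) (Fin n × Fin n) (Series₂ A) :=
  (vInv A - uInv A) • (1 : Matrix (Fin n × Fin n) (Fin n × Fin n) (Series₂ A))
    - (uInv A * vInv A) • flip n A

/-- The relation `R(u-v) T₁(u) T₂(v) = T₂(v) T₁(u) R(u-v)`, imposed for every matrix entry and
every coefficient of `u⁻ʳ v⁻ˢ`. -/
inductive RTT (n : ℕ) : FreeAlgebra ℂ (Gen n) → FreeAlgebra ℂ (Gen n) → Prop
  | rel (a b : Fin n × Fin n) (r s : ℕ) :
      RTT n
        (PowerSeries.coeff s (PowerSeries.coeff r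
          ((clearedR n (FreeAlgebra ℂ (Gen n)) * inFirst (freeT n) * inSecond (freeT n)) a b)))
        (PowerSeries.coeff s (PowerSeries.coeff r
          ((inSecond (freeT n) * inFirst (freeT n) * clearedR n (FreeAlgebra ℂ (Gen n))) a b)))

/-- The Yangian `Y(n)` of `gl_n(ℂ)`. -/
abbrev Yangian (n : ℕ) : Type := RingQuot (RTT n)

/-- The generating matrix `T(u)`, with entries in `Y(n)[[u⁻¹]]`. -/
def T (n : ℕ) : Matrix (Fin n) (Fin n) (PowerSeries (Yangian n)) :=
  (freeT n).map (PowerSeries.map (RingQuot.mkAlgHom ℂ (RTT n)).toRingHom)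

/-! ### Operators on `Y(n)[[u⁻¹]]` -/

/-- The expansion of `(u + c)⁻¹ = u⁻¹ / (1 + c u⁻¹)` in `ℂ[[u⁻¹]]`. -/
def shiftedInv (c : ℂ) : PowerSeries ℂ :=
  PowerSeries.X * (1 + PowerSeries.C c * PowerSeries.X)⁻¹

/-- The shift `g(u) ↦ g(u + c)` of `A[[u⁻¹]]`: if `g(u) = ∑ₖ gₖ u⁻ᵏ` then
`g(u + c) = ∑ₖ gₖ (u + c)⁻ᵏ`. As `(u + c)⁻ᵏ` starts with `u⁻ᵏ`, only the terms `k ≤ m`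
contribute to the coefficient of `u⁻ᵐ`. -/
def shift (A : Type) [Ring A] [Algebra ℂ A] (c : ℂ) : Module.End ℂ (PowerSeries A) where
  toFun g := PowerSeries.mk fun m =>
    ∑ k ∈ Finset.range (m + 1), PowerSeries.coeff m (shiftedInv c ^ k) • PowerSeries.coeff k g
  map_add' f g := by
    ext m
    simp [smul_add, Finset.sum_add_distrib]
  map_smul' a g := by
    ext m
    simp [Finset.smul_sum, smul_comm a]

/-- The algebra of `ℂ`-linear operators on `Y(n)[[u⁻¹]]`. -/
abbrev Op (n : ℕ) : Type := Module.End ℂ (PowerSeries (Yangian n))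

/-- The operator `τ : g(u) ↦ g(u + 1)`. -/
def tau (n : ℕ) : Op n := shift (Yangian n) 1

/-- The operator `τ⁻¹ : g(u) ↦ g(u - 1)`. -/
def tauInv (n : ℕ) : Op n := shift (Yangian n) (-1)

/-- The operator matrix `T(u) τ`; a series `f(u)` acts on `Y(n)[[u⁻¹]]` by left multiplication. -/
def TTau (n : ℕ) : Matrix (Fin n) (Fin n) (Op n) :=
  Matrix.of fun i j => LinearMap.mulLeft ℂ (T n i j) * tau n

/-- The operator matrix `T(u) τ⁻¹`. -/
def TTauInv (n : ℕ) : Matrix (Fin n) (Fin n) (Op n) :=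
  Matrix.of fun i j => LinearMap.mulLeft ℂ (T n i j) * tauInv n

/-! ### Matrices on `(ℂⁿ)^{⊗k}`

`End(ℂⁿ)^{⊗k} ⊗ A` is the algebra of matrices over `A` indexed by `Fin k → Fin n`, the index set
of the standard basis of `(ℂⁿ)^{⊗k}`. -/

/-- `X_s = ∑ 1 ⊗ ⋯ ⊗ E_{ij} ⊗ ⋯ ⊗ 1 ⊗ x_{ij}`, with `E_{ij}` in the place `s`. -/
def inSlot {n k : ℕ} {A : Type} [Ring A] (s : Fin k) (X : Matrix (Fin n) (Fin n) A) :
    Matrix (Fin k → Fin n) (Fin k → Fin n) A :=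
  Matrix.of fun I J => if ∀ r, r ≠ s → I r = J r then X (I s) (J s) else 0

/-- `X^{[k]} = X_1 X_2 ⋯ X_k`. -/
def tensorPow {n : ℕ} {A : Type} [Ring A] (k : ℕ) (X : Matrix (Fin n) (Fin n) A) :
    Matrix (Fin k → Fin n) (Fin k → Fin n) A :=
  (List.ofFn fun s : Fin k => inSlot s X).prod

/-- The action of `σ` on `(ℂⁿ)^{⊗k}` by permuting the tensor components: the basis vector `e_J`
goes to `e_{J ∘ σ⁻¹}`. -/
def permMatrix (n : ℕ) {k : ℕ} (σ : Equiv.Perm (Fin k)) :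
    Matrix (Fin k → Fin n) (Fin k → Fin n) ℂ :=
  Matrix.of fun I J => if I = J ∘ σ.symm then 1 else 0

/-- The antisymmetrizer `A_k`. -/
def antisymmetrizer (n k : ℕ) : Matrix (Fin k → Fin n) (Fin k → Fin n) ℂ :=
  (1 / (k.factorial : ℂ)) •
    ∑ σ : Equiv.Perm (Fin k), ((Equiv.Perm.sign σ : ℤ) : ℂ) • permMatrix n σ

/-- The symmetrizer `S_k`. -/
def symmetrizer (n k : ℕ) : Matrix (Fin k → Fin n) (Fin k → Fin n) ℂ :=
  (1 / (k.factorial : ℂ)) • ∑ σ : Equiv.Perm (Fin k), permMatrix n σ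

/-! ### Symmetric functions -/

/-- `e_k(u,τ) = tr(A_k (T(u) τ⁻¹)^{[k]})`. -/
def e (n k : ℕ) : Op n :=
  Matrix.trace ((antisymmetrizer n k).map (algebraMap ℂ (Op n)) * tensorPow k (TTauInv n))

/-- `h_k(u,τ) = tr(S_k (T(u) τ)^{[k]})`. -/
def h (n k : ℕ) : Op n :=
  Matrix.trace ((symmetrizer n k).map (algebraMap ℂ (Op n)) * tensorPow k (TTau n))

/-- `p⁺_k(u,τ) = tr((T(u) τ)^k)`. -/
def pPlus (n k : ℕ) : Op n := Matrix.trace (TTau n ^ k)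

/-- `p⁻_k(u,τ) = tr((T(u) τ⁻¹)^k)`. -/
def pMinus (n k : ℕ) : Op n := Matrix.trace (TTauInv n ^ k)

/-- `a_1 a_2 ⋯ a_m`, where `a_i = λ_1 + ⋯ + λ_i` are the partial sums of a composition. -/
def partialSumProd {k : ℕ} (c : Composition k) : ℂ :=
  ∏ i : Fin c.length, (c.sizeUpTo (i + 1) : ℂ)

end YangianGL

end

/-! Both formulas are one statement with a parameter θ = ±1: θ = -1 pairs the sign character with
τ⁻¹, θ = 1 pairs the trivial character with τ. At v = u + θ the Yang matrix R(u - v) becomes 1 + θP,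
and the defining relation reads (1 + θP) T₁(u) T₂(u + θ) = T₂(u + θ) T₁(u) (1 + θP) (`T_mul_shift`).
Since (1 + θP)P = θ(1 + θP), the matrix X = T(u)τ^θ satisfies (1 + θP) X₁X₂P = θ(1 + θP) X₁X₂, which
is the Manin property (`isManin_T_shift`).

For such X the twisted column determinants are θ-symmetric in the columns as well as in the rows,
hence invariant under simultaneous permutations. Up to the factor k!, the trace defining `e` or `h`
is the sum E_k of the principal twisted determinants over all index tuples. Expansion along the last
column produces a trace times a smaller such sum, plus equal terms in which one more factor X is
absorbed by the last column. Iteration gives Newton's identities (m + 1) e_{m+1} = ∑ θ^j e_{m-j} tr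
X^{j+1}, with e_k = E_k / k! (`IsManin.newton`). Unfolding the recursion splits off the last block
of a composition at each step, and the divisor is the last partial sum (`eq_sum_composition`). -/

noncomputable section

namespace YangianGL

open Equiv Finset

/-! ### Linear characters of the symmetric groups -/

/-- The linear character of the symmetric group that takes the value `θ` at transpositions. -/
def permChar (θ : ℤˣ) {α : Type*} [DecidableEq α] [Fintype α] : Perm α →* ℤˣ :=
  if θ = 1 then 1 else Perm.sign

theorem permChar_one {α : Type*} [DecidableEq α] [Fintype α] (σ : Perm α) :
    permChar 1 σ = 1 := by
  simp [permChar]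

theorem permChar_neg_one {α : Type*} [DecidableEq α] [Fintype α] (σ : Perm α) :
    permChar (-1) σ = Perm.sign σ := by
  simp [permChar]

theorem permChar_swap (θ : ℤˣ) {α : Type*} [DecidableEq α] [Fintype α] {a b : α} (h : a ≠ b) :
    permChar θ (swap a b) = θ := by
  rcases Int.units_eq_one_or θ with rfl | rfl
  · simp [permChar_one]
  · simp [permChar_neg_one, h]

theorem permChar_permCongr (θ : ℤˣ) {α β : Type*} [DecidableEq α] [Fintype α] [DecidableEq β]
    [Fintype β] (f : α ≃ β) (σ : Perm α) : permChar θ (f.permCongr σ) = permChar θ σ := by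
  rcases Int.units_eq_one_or θ with rfl | rfl
  · simp [permChar_one]
  · simp [permChar_neg_one]

theorem permChar_optionCongr (θ : ℤˣ) {α : Type*} [DecidableEq α] [Fintype α] (σ : Perm α) :
    permChar θ (σ.optionCongr : Perm (Option α)) = permChar θ σ := by
  rcases Int.units_eq_one_or θ with rfl | rfl
  · simp [permChar_one]
  · simp [permChar_neg_one]

/-! ### Twisted column determinants of Manin matrices -/

/-- `X` is a Manin matrix (for `θ = -1`), or its symmetric analogue (for `θ = 1`): twisted `2 × 2`
column determinants are multiplied by `θ` when the two columns are exchanged. -/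
def IsManin (θ : ℤˣ) {n : ℕ} {A : Type} [Ring A] (X : Matrix (Fin n) (Fin n) A) : Prop :=
  ∀ a b c d, X a c * X b d + θ • (X b c * X a d) = θ • (X a d * X b c + θ • (X b d * X a c))

/-- The column determinant (`θ = -1`) or permanent (`θ = 1`) of the matrix `X (L i) (c j)`. -/
def twistedDet (θ : ℤˣ) {n : ℕ} {A : Type} [Ring A] (X : Matrix (Fin n) (Fin n) A) {m : ℕ}
    (L c : Fin m → Fin n) : A :=
  ∑ σ : Perm (Fin m), permChar θ σ • (List.ofFn fun s => X (L (σ s)) (c s)).prod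

/-- `P` and `Q` depend only on the factors away from the two adjacent places, so one pair serves
several products that differ only there. -/
theorem exists_prod_ofFn_eq_mul {A : Type*} [Monoid A] {m : ℕ} (i : Fin m) (f : Fin (m + 1) → A) :
    ∃ P Q : A, ∀ g : Fin (m + 1) → A, (∀ r, r ≠ i.castSucc → r ≠ i.succ → g r = f r) →
      (List.ofFn g).prod = P * (g i.castSucc * g i.succ) * Q := by
  refine ⟨((List.ofFn f).take i).prod, ((List.ofFn f).drop (i + 2)).prod, fun g hg => ?_⟩
  have h1 : (List.ofFn f).take i = (List.ofFn g).take i := by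
    refine List.ext_getElem (by simp) fun j h _ => ?_
    simp only [List.length_take, List.length_ofFn, lt_inf_iff] at h
    simp only [List.getElem_take, List.getElem_ofFn]
    refine (hg _ ?_ ?_).symm <;> simp [Fin.ext_iff] <;> omega
  have h2 : (List.ofFn f).drop (i + 2) = (List.ofFn g).drop (i + 2) := by
    refine List.ext_getElem (by simp) fun j h _ => ?_
    simp only [List.getElem_drop, List.getElem_ofFn]
    refine (hg _ ?_ ?_).symm <;> simp [Fin.ext_iff] <;> omega
  have h3 : List.ofFn g = (List.ofFn g).take i ++
      g i.castSucc :: g i.succ :: (List.ofFn g).drop (i + 2) := by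
    conv_lhs => rw [← List.take_append_drop i (List.ofFn g)]
    rw [List.drop_eq_getElem_cons (by simp), List.drop_eq_getElem_cons (by simp)]
    simp only [List.getElem_ofFn]
    rfl
  rw [h1, h2]
  conv_lhs => rw [h3]
  simp [mul_assoc]

variable {n : ℕ} {A : Type} [Ring A] {θ : ℤˣ} {X : Matrix (Fin n) (Fin n) A}

/-- Row permutations are absorbed by the sum over `σ` and need no commutation relation; column
permutations reorder the factors and need the Manin property. -/
theorem twistedDet_comp_left {m : ℕ} (L c : Fin m → Fin n) (π : Perm (Fin m)) :
    twistedDet θ X (L ∘ π) c = permChar θ π • twistedDet θ X L c := by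
  rw [twistedDet, twistedDet, Finset.smul_sum]
  refine Fintype.sum_equiv (Equiv.mulLeft π) _ _ fun σ => ?_
  simp [smul_smul, ← mul_assoc, Int.units_mul_self]

/-- Each `σ` is paired with `σ * swap a b`. Doubling the sum avoids a choice of coset
representatives; the 2 is cancelled later over ℂ. -/
theorem two_smul_twistedDet {m : ℕ} (L c : Fin m → Fin n) {a b : Fin m} (hab : a ≠ b) :
    2 • twistedDet θ X L c = ∑ σ : Perm (Fin m), permChar θ σ •
      ((List.ofFn fun s => X (L (σ s)) (c s)).prod +
        θ • (List.ofFn fun s => X (L (σ (swap a b s))) (c s)).prod) := by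
  simp only [smul_add, Finset.sum_add_distrib]
  rw [two_smul, twistedDet]
  congr 1
  refine (Fintype.sum_equiv (Equiv.mulRight (swap a b)) _ _ fun σ => ?_).symm
  simp [smul_smul, permChar_swap θ hab]

theorem IsManin.twistedDet_comp_swap [Algebra ℂ A] (hX : IsManin θ X) {m : ℕ}
    (L c : Fin (m + 1) → Fin n) (i : Fin m) :
    twistedDet θ X L (c ∘ swap i.castSucc i.succ) = θ • twistedDet θ X L c := by
  have hi : i.castSucc ≠ i.succ := by simp [Fin.ext_iff]
  have key : 2 • twistedDet θ X L (c ∘ swap i.castSucc i.succ) =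
      2 • (θ • twistedDet θ X L c) := by
    rw [smul_comm 2 θ, two_smul_twistedDet L c hi, two_smul_twistedDet L _ hi, Finset.smul_sum]
    refine Finset.sum_congr rfl fun σ _ => ?_
    rw [smul_comm θ]
    congr 1
    obtain ⟨P, Q, h⟩ := exists_prod_ofFn_eq_mul i fun s => X (L (σ s)) (c s)
    rw [h (fun s => X (L (σ s)) (c s)), h (fun s => X (L (σ (swap i.castSucc i.succ s))) (c s)),
      h (fun s => X (L (σ s)) ((c ∘ swap i.castSucc i.succ) s)),
      h (fun s => X (L (σ (swap i.castSucc i.succ s))) ((c ∘ swap i.castSucc i.succ) s))]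
    · simp only [Function.comp_apply, swap_apply_left, swap_apply_right]
      have := hX (L (σ i.castSucc)) (L (σ i.succ)) (c i.succ) (c i.castSucc)
      have h2 : ∀ x y : A, P * x * Q + θ • (P * y * Q) = P * (x + θ • y) * Q := by
        intro x y
        rw [mul_add, add_mul, mul_smul_comm, smul_mul_assoc]
      rw [h2, h2, this, mul_smul_comm, smul_mul_assoc]
    all_goals
      intro r h1 h2
      simp [swap_apply_of_ne_of_ne h1 h2]
  have h2 : ∀ x y : A, 2 • x = 2 • y → x = y := by
    intro x y h
    have : (2 : ℂ) • x = (2 : ℂ) • y := by simpa [two_smul] using h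
    exact (smul_right_injective A (two_ne_zero (α := ℂ))) this
  exact h2 _ _ key

theorem IsManin.twistedDet_comp_right [Algebra ℂ A] (hX : IsManin θ X) {m : ℕ}
    (L c : Fin m → Fin n) (π : Perm (Fin m)) :
    twistedDet θ X L (c ∘ π) = permChar θ π • twistedDet θ X L c := by
  cases m with
  | zero => simp [Subsingleton.elim π 1]
  | succ m =>
    have hπ : π ∈ Submonoid.closure
        (Set.range fun i : Fin m => swap i.castSucc i.succ) := by
      rw [Perm.mclosure_swap_castSucc_succ]; trivial
    induction hπ using Submonoid.closure_induction generalizing c with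
    | one => simp
    | mem x hx =>
      obtain ⟨i, rfl⟩ := hx
      rw [hX.twistedDet_comp_swap, permChar_swap θ (by simp [Fin.ext_iff])]
    | mul x y _ _ hx hy =>
      rw [Perm.coe_mul, ← Function.comp_assoc, hy, hx, smul_smul, map_mul, mul_comm]

/-- Simultaneous permutation of rows and columns. -/
theorem IsManin.twistedDet_comp_comp [Algebra ℂ A] (hX : IsManin θ X) {m : ℕ}
    (L c : Fin m → Fin n) (π : Perm (Fin m)) :
    twistedDet θ X (L ∘ π) (c ∘ π) = twistedDet θ X L c := by
  rw [hX.twistedDet_comp_right, twistedDet_comp_left, smul_smul, Int.units_mul_self, one_smul]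

/-- Expansion of the twisted determinant along the last column. -/
theorem twistedDet_snoc {m : ℕ} (L c : Fin m → Fin n) (x y : Fin n) :
    twistedDet θ X (Fin.snoc L x : Fin (m + 1) → Fin n) (Fin.snoc c y : Fin (m + 1) → Fin n) =
      twistedDet θ X L c * X x y +
        θ • ∑ b, twistedDet θ X (Function.update L b x) c * X (L b) y := by
  -- Here `none` is the last place. In a pair `(o, σ)`, `o` tells which row meets the last column:
  -- `none` gives the row `x`; `some b` gives `L b`, while `x` takes the place of `b` at the cost of
  -- a factor `θ`.
  let f : Option (Fin m) × Perm (Fin m) ≃ Perm (Fin (m + 1)) :=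
    Perm.decomposeOption.symm.trans finSuccEquivLast.symm.permCongr
  have hL : ∀ o, (Fin.snoc L x : Fin (m + 1) → Fin n) (finSuccEquivLast.symm o) = o.elim x L := by
    rintro (_ | o) <;> simp
  rw [twistedDet, ← f.sum_comp, Fintype.sum_prod_type, Fintype.sum_option]
  congr 1
  · rw [twistedDet, Finset.sum_mul]
    refine Finset.sum_congr rfl fun σ _ => ?_
    simp only [f, Equiv.trans_apply, permChar_permCongr, Perm.decomposeOption_symm_apply,
      swap_self, ← Perm.one_def, one_mul, smul_mul_assoc, List.ofFn_succ', List.prod_concat,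
      permCongr_apply, hL, Equiv.symm_symm, finSuccEquivLast_castSucc, finSuccEquivLast_last]
    simp [permChar_optionCongr]
  · rw [Finset.smul_sum]
    refine Finset.sum_congr rfl fun b _ => ?_
    rw [twistedDet, Finset.sum_mul, Finset.smul_sum]
    refine Finset.sum_congr rfl fun σ _ => ?_
    simp only [f, Equiv.trans_apply, permChar_permCongr, Perm.decomposeOption_symm_apply,
      permChar_optionCongr, smul_mul_assoc, List.ofFn_succ', List.prod_concat, map_mul,
      permCongr_apply, hL, Equiv.symm_symm, finSuccEquivLast_castSucc, finSuccEquivLast_last,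
      permChar_swap θ (Option.some_ne_none b).symm, smul_smul]
    have h : ∀ s, Option.elim (swap none (some b) (some (σ s))) x L =
        Function.update L b x (σ s) := by
      intro s
      by_cases hs : σ s = b
      · simp [hs]
      · rw [swap_apply_of_ne_of_ne (by simp) (by simpa using hs)]
        simp [hs]
    simp [h]

/-! ### Newton identities -/

/-- `k!` times the `k`-th elementary (`θ = -1`) or complete (`θ = 1`) symmetric function of `X`. -/
def principalSum (θ : ℤˣ) (X : Matrix (Fin n) (Fin n) A) (k : ℕ) : A :=
  ∑ J : Fin k → Fin n, twistedDet θ X J J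

/-- The sum of twisted principal minors of size `m + 1` with the last factor `X` replaced
by `X * Z`. -/
def hookSum (θ : ℤˣ) (X : Matrix (Fin n) (Fin n) A) (m : ℕ) (Z : Matrix (Fin n) (Fin n) A) : A :=
  ∑ J : Fin m → Fin n, ∑ x, ∑ y, twistedDet θ X (Fin.snoc J x : Fin (m + 1) → Fin n)
    (Fin.snoc J y : Fin (m + 1) → Fin n) * Z y x

theorem sum_fun_snoc {B : Type*} [AddCommMonoid B] {m : ℕ} (F : (Fin (m + 1) → Fin n) → B) :
    ∑ J, F J = ∑ J : Fin m → Fin n, ∑ x, F (Fin.snoc J x : Fin (m + 1) → Fin n) := by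
  rw [← (Fin.snocEquiv fun _ : Fin (m + 1) => Fin n).sum_comp, Fintype.sum_prod_type,
    Finset.sum_comm]
  rfl

theorem principalSum_succ (m : ℕ) : principalSum θ X (m + 1) = hookSum θ X m 1 := by
  simp [principalSum, hookSum, sum_fun_snoc, Matrix.one_apply]

/-- A simultaneous permutation of rows and columns moves the place `b` to the end, so every `b`
contributes the same amount. -/
theorem IsManin.sum_update_eq [Algebra ℂ A] (hX : IsManin θ X) {m : ℕ} (b : Fin (m + 1))
    (x : Fin n) (v : Fin n → A) :
    ∑ J : Fin (m + 1) → Fin n, twistedDet θ X (Function.update J b x) J * v (J b) =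
      ∑ J : Fin m → Fin n, ∑ y, twistedDet θ X (Fin.snoc J x : Fin (m + 1) → Fin n)
        (Fin.snoc J y : Fin (m + 1) → Fin n) * v y := by
  let π := swap b (Fin.last m)
  rw [← (π.arrowCongr (Equiv.refl (Fin n))).sum_comp, sum_fun_snoc]
  refine Finset.sum_congr rfl fun J _ => Finset.sum_congr rfl fun y _ => ?_
  have h1 : (π.arrowCongr (Equiv.refl (Fin n))) (Fin.snoc J y : Fin (m + 1) → Fin n) =
      (Fin.snoc J y : Fin (m + 1) → Fin n) ∘ π := by
    ext; simp [π, Equiv.arrowCongr]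
  have h2 : Function.update ((Fin.snoc J y : Fin (m + 1) → Fin n) ∘ π) b x =
      (Fin.snoc J x : Fin (m + 1) → Fin n) ∘ π := by
    have hu : (Fin.snoc J x : Fin (m + 1) → Fin n) =
        Function.update (Fin.snoc J y : Fin (m + 1) → Fin n) (Fin.last m) x :=
      (Fin.update_snoc_last (α := fun _ : Fin (m + 1) => Fin n) y J x).symm
    rw [hu]
    ext s
    by_cases hs : s = b
    · subst hs; simp [π]
    · have : π s ≠ Fin.last m := by
        intro h
        apply hs
        rw [← π.injective.eq_iff, h]
        simp [π]
      simp [hs, this]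
  rw [h1, h2, hX.twistedDet_comp_comp]
  simp [π]

theorem hookSum_zero (Z : Matrix (Fin n) (Fin n) A) :
    hookSum θ X 0 Z = principalSum θ X 0 * (X * Z).trace := by
  simp [hookSum, principalSum, twistedDet_snoc, Matrix.trace, Matrix.mul_apply, mul_assoc,
    Finset.mul_sum]

/-- Expansion along the last column: the diagonal term gives the trace, and the `m + 1` other terms
agree by `sum_update_eq`. -/
theorem IsManin.hookSum_succ [Algebra ℂ A] (hX : IsManin θ X) (m : ℕ)
    (Z : Matrix (Fin n) (Fin n) A) :
    hookSum θ X (m + 1) Z = principalSum θ X (m + 1) * (X * Z).trace +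
      (m + 1) • θ • hookSum θ X m (X * Z) := by
  have h1 : principalSum θ X (m + 1) * (X * Z).trace =
      ∑ J : Fin (m + 1) → Fin n, ∑ x, ∑ y, twistedDet θ X J J * X x y * Z y x := by
    rw [principalSum, Finset.sum_mul]
    refine Finset.sum_congr rfl fun J _ => ?_
    simp [Matrix.trace, Matrix.mul_apply, Finset.mul_sum, mul_assoc]
  -- The sum over `y` turns `X (J b) y * Z y x` into an entry of `X * Z`.
  have h2 : ∀ b : Fin (m + 1), ∑ J : Fin (m + 1) → Fin n, ∑ x, ∑ y,
      twistedDet θ X (Function.update J b x) J * X (J b) y * Z y x = hookSum θ X m (X * Z) := by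
    intro b
    rw [hookSum, Finset.sum_comm, Finset.sum_comm (γ := Fin m → Fin n)]
    refine Finset.sum_congr rfl fun x _ => ?_
    rw [← hX.sum_update_eq b x fun z => (X * Z) z x]
    refine Finset.sum_congr rfl fun J _ => ?_
    simp [Matrix.mul_apply, Finset.mul_sum, mul_assoc]
  have h3 : (m + 1) • θ • hookSum θ X m (X * Z) = ∑ J : Fin (m + 1) → Fin n, ∑ x, ∑ y,
      θ • ∑ b : Fin (m + 1),
        twistedDet θ X (Function.update J b x) J * X (J b) y * Z y x := by
    have : (m + 1) • θ • hookSum θ X m (X * Z) = θ • ∑ b : Fin (m + 1),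
        ∑ J : Fin (m + 1) → Fin n, ∑ x, ∑ y,
          twistedDet θ X (Function.update J b x) J * X (J b) y * Z y x := by
      simp only [h2, Finset.sum_const, Finset.card_univ, Fintype.card_fin]
      rw [smul_comm]
    rw [this, Finset.sum_comm, Finset.smul_sum]
    refine Finset.sum_congr rfl fun J _ => ?_
    rw [Finset.sum_comm, Finset.smul_sum]
    refine Finset.sum_congr rfl fun x _ => ?_
    rw [Finset.sum_comm, Finset.smul_sum]
  rw [h1, h3, hookSum]
  simp only [← Finset.sum_add_distrib]
  refine Finset.sum_congr rfl fun J _ => Finset.sum_congr rfl fun x _ =>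
    Finset.sum_congr rfl fun y _ => ?_
  rw [twistedDet_snoc, add_mul, smul_mul_assoc, Finset.sum_mul]

/-- The elementary (`θ = -1`) or complete (`θ = 1`) symmetric function of a matrix. -/
def twistedSymm (θ : ℤˣ) [Algebra ℂ A] (X : Matrix (Fin n) (Fin n) A) (k : ℕ) : A :=
  (1 / (k.factorial : ℂ)) • principalSum θ X k

/-- Iteration of `hookSum_succ`. The exponent `i` must be arbitrary because each step turns `X ^ i`
into `X ^ (i + 1)`; the factor `m + 1` cancels against the factorial. -/
theorem IsManin.hookSum_eq [Algebra ℂ A] (hX : IsManin θ X) (m i : ℕ) :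
    (1 / (m.factorial : ℂ)) • hookSum θ X m (X ^ i) =
      ∑ j ∈ range (m + 1), θ ^ j • (twistedSymm θ X (m - j) * (X ^ (i + j + 1)).trace) := by
  induction m generalizing i with
  | zero => simp [hookSum_zero, twistedSymm, pow_succ']
  | succ m ih =>
    have h : (1 / ((m + 1).factorial : ℂ)) • (m + 1) • θ • hookSum θ X m (X ^ (i + 1)) =
        θ • (1 / (m.factorial : ℂ)) • hookSum θ X m (X ^ (i + 1)) := by
      rw [smul_comm θ, ← Nat.cast_smul_eq_nsmul ℂ, smul_smul]
      congr 1
      have : (m.factorial : ℂ) ≠ 0 := by exact_mod_cast m.factorial_ne_zero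
      have : (m + 1 : ℂ) ≠ 0 := by exact_mod_cast m.succ_ne_zero
      rw [Nat.factorial_succ]
      push_cast
      field_simp
    rw [hX.hookSum_succ, smul_add, ← pow_succ', h, ih, Finset.sum_range_succ' _ (m + 1), add_comm,
      Finset.smul_sum]
    congr 1
    · refine Finset.sum_congr rfl fun j _ => ?_
      rw [smul_smul, ← pow_succ', Nat.add_sub_add_right]
      congr 5
      ring
    · simp [twistedSymm]

/-- Newton's identities for Manin matrices. -/
theorem IsManin.newton [Algebra ℂ A] (hX : IsManin θ X) (m : ℕ) :
    twistedSymm θ X (m + 1) = (1 / (m + 1 : ℂ)) •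
      ∑ j ∈ range (m + 1), θ ^ j • (twistedSymm θ X (m - j) * (X ^ (j + 1)).trace) := by
  have h := hX.hookSum_eq m 0
  simp only [pow_zero, zero_add] at h
  rw [← h, twistedSymm, principalSum_succ, smul_smul, Nat.factorial_succ]
  congr 1
  push_cast
  rw [one_div_mul_one_div]

end YangianGL

end

noncomputable section

namespace YangianGL

open Finset

/-! ### Sums over compositions -/

/-- Append a last block to a composition of `j` to get a composition of `k`. -/
def appendBlock {k : ℕ} (p : Σ j : Fin k, Composition j) : Composition k where
  blocks := p.2.blocks ++ [k - p.1]
  blocks_pos := by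
    intro i hi
    rcases List.mem_append.1 hi with h | h
    · exact p.2.blocks_pos h
    · have := p.1.2
      simp only [List.mem_singleton] at h
      omega
  blocks_sum := by
    have := p.1.2
    rw [List.sum_append, p.2.blocks_sum]
    simp

theorem appendBlock_bijective {k : ℕ} (hk : k ≠ 0) :
    Function.Bijective (appendBlock (k := k)) := by
  constructor
  · rintro ⟨⟨i, hi⟩, c⟩ ⟨⟨j, hj⟩, d⟩ h
    have hb := congrArg Composition.blocks h
    simp only [appendBlock] at hb
    obtain ⟨h1, h2⟩ := List.append_inj' hb rfl
    have hij : i = j := by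
      have := List.singleton_injective h2
      omega
    subst hij
    rw [Composition.ext h1]
  · intro c
    have hne : c.blocks ≠ [] := by simpa [Composition.blocks_eq_nil] using hk
    have hc := List.dropLast_append_getLast hne
    have hs : c.blocks.dropLast.sum + c.blocks.getLast hne = k := by
      have := congrArg List.sum hc
      rwa [List.sum_append, List.sum_singleton, c.blocks_sum] at this
    have hp : 0 < c.blocks.getLast hne := c.blocks_pos (List.getLast_mem hne)
    refine ⟨⟨⟨c.blocks.dropLast.sum, by omega⟩, ⟨c.blocks.dropLast, fun {i} hi =>
      c.blocks_pos (List.mem_of_mem_dropLast hi), rfl⟩⟩, ?_⟩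
    refine Composition.ext ?_
    simp only [appendBlock]
    conv_rhs => rw [← hc]
    congr 2
    omega

theorem appendBlock_length {k : ℕ} (p : Σ j : Fin k, Composition j) :
    (appendBlock p).length = p.2.length + 1 := by
  simp [appendBlock, Composition.length]

/-- A product over `range` does not carry the length in its index type, so lengths can be rewritten.
-/
theorem partialSumProd_eq {k : ℕ} (c : Composition k) :
    partialSumProd c = ∏ i ∈ range c.length, (c.sizeUpTo (i + 1) : ℂ) := by
  rw [partialSumProd, Finset.prod_range fun i => (c.sizeUpTo (i + 1) : ℂ)]

theorem partialSumProd_appendBlock {k : ℕ} (p : Σ j : Fin k, Composition j) :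
    partialSumProd (appendBlock p) = partialSumProd p.2 * k := by
  rw [partialSumProd_eq, partialSumProd_eq, appendBlock_length, Finset.prod_range_succ,
    ← appendBlock_length, Composition.sizeUpTo_length]
  congr 1
  refine Finset.prod_congr rfl fun i hi => ?_
  have : i + 1 ≤ p.2.blocks.length := by simpa using hi
  simp [Composition.sizeUpTo, appendBlock, List.take_append_of_le_length this]

/-- A sequence that satisfies the Newton recursion is given by a sum over compositions. -/
theorem eq_sum_composition {A : Type} [Ring A] [Algebra ℂ A] (z : ℂ) (E p : ℕ → A)
    (h0 : E 0 = 1)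
    (h : ∀ m, E (m + 1) = (1 / (m + 1 : ℂ)) •
      ∑ j ∈ range (m + 1), z ^ j • (E (m - j) * p (j + 1))) (k : ℕ) :
    E k = ∑ c : Composition k, (z ^ (k - c.length) / partialSumProd c) •
      (c.blocks.map p).prod := by
  induction k using Nat.strong_induction_on with
  | _ k ih =>
    cases k with
    | zero =>
      have hb : ∀ c : Composition 0, c.blocks = [] := fun c => by simp
      have hl : ∀ c : Composition 0, c.length = 0 := fun c => by simp
      have hs : Fintype.card (Composition 0) = 1 := by simp [composition_card]
      simp [h0, partialSumProd_eq, hb, hl, hs]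
    | succ m =>
      -- After reflection `j` is the size of what precedes the last block, and that block is `m + 1
      -- - j`.
      rw [h, ← Finset.sum_range_reflect, ← (appendBlock_bijective m.succ_ne_zero).sum_comp,
        Fintype.sum_sigma, Finset.sum_range, Finset.smul_sum]
      refine Finset.sum_congr rfl fun j _ => ?_
      have hj := j.2
      rw [show m - (m + 1 - 1 - (j : ℕ)) = j by omega, ih j hj,
        show m + 1 - 1 - (j : ℕ) + 1 = m + 1 - j by omega, Finset.sum_mul, Finset.smul_sum,
        Finset.smul_sum]
      refine Finset.sum_congr rfl fun c _ => ?_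
      have hc := c.length_le
      rw [partialSumProd_appendBlock, appendBlock_length, smul_mul_assoc, smul_smul, smul_smul]
      have hprod : ((appendBlock ⟨j, c⟩).blocks.map p).prod =
          (c.blocks.map p).prod * p (m + 1 - j) := by
        simp [appendBlock]
      rw [hprod]
      congr 1
      -- The last block contributes its size minus one to the exponent of `z`; `c.length ≤ j` keeps
      -- the natural subtractions exact.
      rw [show m + 1 - (c.length + 1) = (m + 1 - 1 - j) + (j - c.length) by omega, pow_add]
      push_cast
      rw [div_eq_mul_inv, div_eq_mul_inv, div_eq_mul_inv, mul_inv]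
      ring

end YangianGL

end

noncomputable section

namespace YangianGL

open Finset PowerSeries

/-! ### The shift of power series -/

section Shift

variable {A : Type} [Ring A] [Algebra ℂ A]

theorem shiftedInv_mul (c : ℂ) :
    shiftedInv c * (1 + PowerSeries.C c * PowerSeries.X) = PowerSeries.X := by
  rw [shiftedInv, mul_assoc, PowerSeries.inv_mul_cancel _ (by simp), mul_one]

theorem coeff_shiftedInv_pow (c : ℂ) {m k : ℕ} (h : m < k) : coeff m (shiftedInv c ^ k) = 0 := by
  rw [shiftedInv, mul_pow, coeff_X_pow_mul', if_neg (by omega)]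

theorem coeff_shift (c : ℂ) (g : PowerSeries A) {m N : ℕ} (h : m < N) :
    coeff m (shift A c g) = ∑ k ∈ range N, coeff m (shiftedInv c ^ k) • coeff k g := by
  have : coeff m (shift A c g) =
      ∑ k ∈ range (m + 1), coeff m (shiftedInv c ^ k) • coeff k g := by
    simp [shift]
  rw [this]
  refine Finset.sum_subset (by simpa using h) fun k _ hk => ?_
  rw [coeff_shiftedInv_pow c (by simpa using hk), zero_smul]

theorem shift_mul (c : ℂ) (f g : PowerSeries A) :
    shift A c (f * g) = shift A c f * shift A c g := by
  ext m
  have hR : coeff m (shift A c f * shift A c g) = ∑ i ∈ range (m + 1), ∑ j ∈ range (m + 1),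
      coeff m (shiftedInv c ^ (i + j)) • (coeff i f * coeff j g) := by
    rw [coeff_mul]
    have : ∀ p ∈ antidiagonal m, coeff p.1 (shift A c f) * coeff p.2 (shift A c g) =
        ∑ i ∈ range (m + 1), ∑ j ∈ range (m + 1),
          (coeff p.1 (shiftedInv c ^ i) * coeff p.2 (shiftedInv c ^ j)) •
            (coeff i f * coeff j g) := by
      intro p hp
      have hp' := HasAntidiagonal.mem_antidiagonal.1 hp
      rw [coeff_shift c f (show p.1 < m + 1 by omega), coeff_shift c g (show p.2 < m + 1 by omega),
        Finset.sum_mul_sum]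
      simp only [smul_mul_smul_comm]
    rw [Finset.sum_congr rfl this, Finset.sum_comm]
    refine Finset.sum_congr rfl fun i _ => ?_
    rw [Finset.sum_comm]
    refine Finset.sum_congr rfl fun j _ => ?_
    rw [← Finset.sum_smul, pow_add, coeff_mul]
  -- This bound makes room for `k = i + j` with all `i, j ≤ m`; pairs outside that square have `k >
  -- m` and contribute zero.
  rw [hR, coeff_shift c _ (show m < 2 * m + 1 by omega)]
  simp only [coeff_mul, Finset.smul_sum]
  rw [← Finset.sum_product', Finset.sum_sigma']
  symm
  refine Finset.sum_of_injOn (fun p => ⟨p.1 + p.2, p⟩) ?_ ?_ ?_ ?_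
  · intro p _ q _ h
    simp only [Sigma.mk.injEq] at h
    exact eq_of_heq h.2
  · intro p hp
    simp only [coe_product, coe_range, Set.mem_prod, Set.mem_Iio] at hp
    simp
    omega
  · rintro ⟨k, p⟩ hk hn
    simp only [mem_sigma, mem_range, HasAntidiagonal.mem_antidiagonal] at hk
    have : m < k := by
      by_contra hmk
      apply hn
      obtain ⟨hk, rfl⟩ := hk
      refine ⟨p, ?_, rfl⟩
      simp
      omega
    simp [coeff_shiftedInv_pow c this]
  · intro p _
    simp

theorem shift_C (c : ℂ) (a : A) : shift A c (PowerSeries.C a) = PowerSeries.C a := by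
  ext m
  rw [coeff_shift c _ (Nat.lt_succ_self m), Finset.sum_range_succ', Finset.sum_eq_zero]
  · simp [coeff_one, coeff_C]
  · intro k _
    simp

theorem shift_X (c : ℂ) :
    shift A c PowerSeries.X = PowerSeries.map (algebraMap ℂ A) (shiftedInv c) := by
  ext m
  rw [coeff_shift c _ (show m < m + 2 by omega), Finset.sum_eq_single 1]
  · simp [Algebra.algebraMap_eq_smul_one]
  · intro k _ hk
    simp [coeff_X, hk]
  · simp

theorem shift_X_mul_cancel (c : ℂ) :
    shift A c PowerSeries.X * (1 + PowerSeries.C (algebraMap ℂ A c) * PowerSeries.X) =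
      PowerSeries.X := by
  have := congrArg (PowerSeries.map (algebraMap ℂ A)) (shiftedInv_mul c)
  simpa [shift_X] using this

/-- The substitution `v = u + c` in a series in `u⁻¹` and `v⁻¹`. -/
def specialize (c : ℂ) : Series₂ A →+ PowerSeries A where
  toFun F := PowerSeries.mk fun m =>
    ∑ p ∈ antidiagonal m, coeff p.2 (shift A c (coeff p.1 F))
  map_zero' := by ext; simp
  map_add' F G := by ext; simp [Finset.sum_add_distrib]

theorem coeff_specialize (c : ℂ) (F : Series₂ A) (m : ℕ) : coeff m (specialize c F) =
    ∑ p ∈ antidiagonal m, coeff p.2 (shift A c (coeff p.1 F)) := by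
  simp [specialize]

/-- `specialize` is only set up as an additive map; this and the next three product rules cover
every term of the defining relation. -/
theorem specialize_uInv_mul (c : ℂ) (F : Series₂ A) :
    specialize c (uInv A * F) = PowerSeries.X * specialize c F := by
  ext m
  rw [coeff_specialize, uInv]
  cases m with
  | zero => simp
  | succ m =>
    rw [coeff_succ_X_mul, coeff_specialize, Finset.Nat.sum_antidiagonal_succ]
    simp [coeff_succ_X_mul]

theorem specialize_vInv_mul (c : ℂ) (F : Series₂ A) :
    specialize c (vInv A * F) = shift A c PowerSeries.X * specialize c F := by
  ext m
  simp only [coeff_specialize, vInv, coeff_C_mul, shift_mul]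
  simp only [coeff_mul, coeff_specialize, Finset.mul_sum]
  rw [Finset.sum_sigma', Finset.sum_sigma']
  refine Finset.sum_bij' (fun x _ => ⟨(x.2.1, x.1.1 + x.2.2), (x.1.1, x.2.2)⟩)
    (fun x _ => ⟨(x.2.1, x.1.1 + x.2.2), (x.1.1, x.2.2)⟩) ?_ ?_ ?_ ?_ ?_
  · rintro ⟨⟨a, b⟩, ⟨p, q⟩⟩ h
    simp at h ⊢
    omega
  · rintro ⟨⟨a, b⟩, ⟨p, q⟩⟩ h
    simp at h ⊢
    omega
  · rintro ⟨⟨a, b⟩, ⟨p, q⟩⟩ h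
    simp at h ⊢
    omega
  · rintro ⟨⟨a, b⟩, ⟨p, q⟩⟩ h
    simp at h ⊢
    omega
  · rintro ⟨⟨a, b⟩, ⟨p, q⟩⟩ h
    rfl

theorem specialize_map_C_mul_C (c : ℂ) (f g : PowerSeries A) :
    specialize c (PowerSeries.map PowerSeries.C f * PowerSeries.C g) = f * shift A c g := by
  ext m
  simp [coeff_specialize, coeff_mul_C, shift_mul, shift_C, coeff_mul (φ := f)]

theorem specialize_C_mul_map_C (c : ℂ) (f g : PowerSeries A) :
    specialize c (PowerSeries.C g * PowerSeries.map PowerSeries.C f) = shift A c g * f := by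
  ext m
  rw [coeff_mul, ← Finset.Nat.sum_antidiagonal_swap]
  simp [coeff_specialize, shift_mul, shift_C]

end Shift

/-! ### The generating matrix of the Yangian -/

theorem clearedR_entry {n : ℕ} {A : Type} [Ring A] (a b : Fin n × Fin n) :
    clearedR n A a b = (vInv A - uInv A) * (if a = b then 1 else 0) -
      (uInv A * vInv A) * (if a.swap = b then 1 else 0) := by
  have : (a.1 = b.2 ∧ a.2 = b.1) ↔ a.swap = b := by
    rw [Prod.ext_iff]; simp [and_comm]
  simp [clearedR, flip, Matrix.one_apply, this]

theorem clearedR_mul {n : ℕ} {A : Type} [Ring A]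
    (M : Matrix (Fin n × Fin n) (Fin n × Fin n) (Series₂ A)) (a b : Fin n × Fin n) :
    (clearedR n A * M) a b = (vInv A - uInv A) * M a b - uInv A * vInv A * M a.swap b := by
  simp [Matrix.mul_apply, clearedR_entry, sub_mul, Finset.sum_sub_distrib]

theorem uInv_comm {A : Type} [Ring A] (F : Series₂ A) : F * uInv A = uInv A * F :=
  (PowerSeries.commute_X F).eq

theorem vInv_comm {A : Type} [Ring A] (F : Series₂ A) : F * vInv A = vInv A * F := by
  ext1 r
  rw [vInv, coeff_mul_C, coeff_C_mul, (PowerSeries.commute_X _).eq]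

theorem mul_clearedR {n : ℕ} {A : Type} [Ring A]
    (M : Matrix (Fin n × Fin n) (Fin n × Fin n) (Series₂ A)) (a b : Fin n × Fin n) :
    (M * clearedR n A) a b = (vInv A - uInv A) * M a b - uInv A * vInv A * M a b.swap := by
  have h : ∀ x : Fin n × Fin n, x.swap = b ↔ x = b.swap := fun x => Prod.swap_eq_iff_eq_swap
  simp only [Matrix.mul_apply, clearedR_entry, mul_sub, Finset.sum_sub_distrib, h]
  have h1 : ∀ F : Series₂ A, F * (vInv A - uInv A) = (vInv A - uInv A) * F := fun F => by
    rw [mul_sub, sub_mul, uInv_comm, vInv_comm]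
  have h2 : ∀ F : Series₂ A, F * (uInv A * vInv A) = uInv A * vInv A * F := fun F => by
    rw [← mul_assoc, uInv_comm, mul_assoc, vInv_comm, mul_assoc]
  simp [h1, h2]

theorem inFirst_mul_inSecond {n : ℕ} {A : Type} [Ring A]
    (M : Matrix (Fin n) (Fin n) (PowerSeries A)) (a b : Fin n × Fin n) :
    (inFirst M * inSecond M) a b =
      PowerSeries.map PowerSeries.C (M a.1 b.1) * PowerSeries.C (M a.2 b.2) := by
  simp [Matrix.mul_apply, inFirst, inSecond, Fintype.sum_prod_type]

theorem inSecond_mul_inFirst {n : ℕ} {A : Type} [Ring A]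
    (M : Matrix (Fin n) (Fin n) (PowerSeries A)) (a b : Fin n × Fin n) :
    (inSecond M * inFirst M) a b =
      PowerSeries.C (M a.2 b.2) * PowerSeries.map PowerSeries.C (M a.1 b.1) := by
  simp [Matrix.mul_apply, inFirst, inSecond, Fintype.sum_prod_type]

/-- An entry of the left-hand side of the defining relation. -/
def rttLeft {n : ℕ} {A : Type} [Ring A] (M : Matrix (Fin n) (Fin n) (PowerSeries A))
    (a b : Fin n × Fin n) : Series₂ A :=
  (clearedR n A * inFirst M * inSecond M) a b

/-- An entry of the right-hand side of the defining relation. -/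
def rttRight {n : ℕ} {A : Type} [Ring A] (M : Matrix (Fin n) (Fin n) (PowerSeries A))
    (a b : Fin n × Fin n) : Series₂ A :=
  (inSecond M * inFirst M * clearedR n A) a b

theorem rttLeft_eq {n : ℕ} {A : Type} [Ring A] (M : Matrix (Fin n) (Fin n) (PowerSeries A))
    (a b : Fin n × Fin n) : rttLeft M a b =
      (vInv A - uInv A) *
        (PowerSeries.map PowerSeries.C (M a.1 b.1) * PowerSeries.C (M a.2 b.2)) -
      uInv A * vInv A *
        (PowerSeries.map PowerSeries.C (M a.2 b.1) * PowerSeries.C (M a.1 b.2)) := by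
  rw [rttLeft, Matrix.mul_assoc, clearedR_mul, inFirst_mul_inSecond, inFirst_mul_inSecond]
  rfl

theorem rttRight_eq {n : ℕ} {A : Type} [Ring A] (M : Matrix (Fin n) (Fin n) (PowerSeries A))
    (a b : Fin n × Fin n) : rttRight M a b =
      (vInv A - uInv A) *
        (PowerSeries.C (M a.2 b.2) * PowerSeries.map PowerSeries.C (M a.1 b.1)) -
      uInv A * vInv A *
        (PowerSeries.C (M a.2 b.1) * PowerSeries.map PowerSeries.C (M a.1 b.2)) := by
  rw [rttRight, mul_clearedR, inSecond_mul_inFirst, inSecond_mul_inFirst]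
  rfl

section Map

variable {A B : Type} [Ring A] [Ring B] (φ : A →+* B)

theorem map_map_uInv : PowerSeries.map (PowerSeries.map φ) (uInv A) = uInv B := by
  simp [uInv]

theorem map_map_vInv : PowerSeries.map (PowerSeries.map φ) (vInv A) = vInv B := by
  simp [vInv]

theorem map_map_map_C (f : PowerSeries A) :
    PowerSeries.map (PowerSeries.map φ) (PowerSeries.map PowerSeries.C f) =
      PowerSeries.map PowerSeries.C (PowerSeries.map φ f) := by
  ext; simp [coeff_C]

/-- Naturality in the coefficient ring carries the relation from the free algebra, where it is
imposed, to the Yangian. -/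
theorem map_rttLeft {n : ℕ} (M : Matrix (Fin n) (Fin n) (PowerSeries A)) (a b : Fin n × Fin n) :
    PowerSeries.map (PowerSeries.map φ) (rttLeft M a b) =
      rttLeft (M.map (PowerSeries.map φ)) a b := by
  simp [rttLeft_eq, map_map_uInv, map_map_vInv, map_map_map_C]

theorem map_rttRight {n : ℕ} (M : Matrix (Fin n) (Fin n) (PowerSeries A)) (a b : Fin n × Fin n) :
    PowerSeries.map (PowerSeries.map φ) (rttRight M a b) =
      rttRight (M.map (PowerSeries.map φ)) a b := by
  simp [rttRight_eq, map_map_uInv, map_map_vInv, map_map_map_C]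

end Map

/-- The defining relation holds in the Yangian. -/
theorem rttLeft_T (n : ℕ) (a b : Fin n × Fin n) : rttLeft (T n) a b = rttRight (T n) a b := by
  rw [T, ← map_rttLeft, ← map_rttRight]
  ext r s
  simp only [coeff_map]
  exact RingQuot.mkAlgHom_rel ℂ (RTT.rel a b r s)

/-- Removes the factor u⁻¹(u + c)⁻¹ left from clearing denominators: multiplication by 1 + c u⁻¹
turns (u + c)⁻¹ into u⁻¹, which is cancellable. -/
theorem eq_of_X_mul_shift_X_mul {A : Type} [Ring A] [Algebra ℂ A] (c : ℂ) {f g : PowerSeries A}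
    (h : PowerSeries.X * (shift A c PowerSeries.X * f) =
      PowerSeries.X * (shift A c PowerSeries.X * g)) : f = g := by
  have hX : ∀ {f g : PowerSeries A}, PowerSeries.X * f = PowerSeries.X * g → f = g := by
    intro f g h
    ext m
    have := congrArg (coeff (m + 1)) h
    simpa [coeff_succ_X_mul] using this
  have hc : (1 + PowerSeries.C (algebraMap ℂ A c) * PowerSeries.X) * shift A c PowerSeries.X =
      PowerSeries.X := by
    have h2 : Commute (shift A c PowerSeries.X)
        (1 + PowerSeries.C (algebraMap ℂ A c) * PowerSeries.X) := by
      have := ((Commute.all (shiftedInv c) (1 + PowerSeries.C c * PowerSeries.X)).map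
        (PowerSeries.map (algebraMap ℂ A)))
      simpa [shift_X] using this
    rw [← h2.eq, shift_X_mul_cancel]
  have := congrArg ((1 + PowerSeries.C (algebraMap ℂ A c) * PowerSeries.X) * ·) (hX h)
  simp only [← mul_assoc, hc] at this
  exact hX this

/-- With v = u + θ this is v⁻¹ - u⁻¹ = -θ u⁻¹v⁻¹, so the cleared Yang matrix becomes -θ u⁻¹v⁻¹ (1 +
θP). -/
theorem shift_X_sub_X {A : Type} [Ring A] [Algebra ℂ A] (θ : ℤˣ) :
    shift A (θ : ℤ) PowerSeries.X - PowerSeries.X =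
      -(θ • (PowerSeries.X * shift A (θ : ℤ) PowerSeries.X)) := by
  have h1 := shift_X_mul_cancel (A := A) ((θ : ℤ) : ℂ)
  have h2 : PowerSeries.C (algebraMap ℂ A ((θ : ℤ) : ℂ)) * PowerSeries.X =
      θ • (PowerSeries.X : PowerSeries A) := by
    rcases Int.units_eq_one_or θ with rfl | rfl <;> simp
  rw [h2, mul_add, mul_one, mul_smul_comm, (PowerSeries.commute_X _).eq] at h1
  rw [← sub_eq_zero, ← sub_eq_zero.2 h1]
  abel

theorem mul_mul_add_smul_eq {R : Type*} [Ring R] {θ : ℤˣ} {x w p q r s : R}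
    (hs : w - x = -(θ • (x * w)))
    (h : w * p - x * p - x * (w * q) = w * r - x * r - x * (w * s)) :
    x * (w * (p + θ • q)) = x * (w * (r + θ • s)) := by
  rw [← sub_mul, ← sub_mul, hs] at h
  rcases Int.units_eq_one_or θ with rfl | rfl
  · simp only [one_smul, mul_add, neg_mul, mul_assoc] at h ⊢
    rw [← neg_inj, neg_add', h, neg_add']
  · simp only [Units.neg_smul, one_smul, mul_add, mul_assoc, neg_neg, mul_neg] at h ⊢
    rw [← sub_eq_add_neg, ← sub_eq_add_neg, h]

/-- The defining relation at `v = u + θ`. -/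
theorem T_mul_shift (n : ℕ) (θ : ℤˣ) (a b c d : Fin n) :
    T n a c * shift _ (θ : ℤ) (T n b d) + θ • (T n b c * shift _ (θ : ℤ) (T n a d)) =
      shift _ (θ : ℤ) (T n b d) * T n a c + θ • (shift _ (θ : ℤ) (T n b c) * T n a d) := by
  have h := congrArg (specialize ((θ : ℤ) : ℂ)) (rttLeft_T n (a, b) (c, d))
  simp only [rttLeft_eq, rttRight_eq, sub_mul, mul_assoc, map_sub, specialize_uInv_mul,
    specialize_vInv_mul, specialize_map_C_mul_C, specialize_C_mul_map_C] at h
  refine eq_of_X_mul_shift_X_mul ((θ : ℤ) : ℂ) ?_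
  exact mul_mul_add_smul_eq (shift_X_sub_X θ) h

end YangianGL

end

noncomputable section

namespace YangianGL

open Finset

/-! ### Traces over tensor powers -/

/-- Arbitrary lists of distinct slots make the induction possible; `tensorPow` is the case of all
slots. -/
theorem prod_map_inSlot_apply {n k : ℕ} {A : Type} [Ring A] (X : Matrix (Fin n) (Fin n) A)
    (l : List (Fin k)) (hl : l.Nodup) (I J : Fin k → Fin n) :
    (l.map fun s => inSlot s X).prod I J =
      if ∀ r, r ∉ l → I r = J r then (l.map fun s => X (I s) (J s)).prod else 0 := by
  induction l generalizing I with
  | nil => simp [Matrix.one_apply, funext_iff]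
  | cons s l ih =>
    obtain ⟨hs, hl⟩ := List.nodup_cons.1 hl
    -- The first factor fixes the intermediate index off `s`; the others leave slot `s` alone and
    -- force the value `J s` there.
    rw [List.map_cons, List.prod_cons, Matrix.mul_apply,
      Finset.sum_eq_single (Function.update I s (J s))]
    · rw [ih hl]
      have h1 : (∀ r, r ∉ l → Function.update I s (J s) r = J r) ↔
          ∀ r, r ∉ s :: l → I r = J r := by
        refine forall_congr' fun r => ?_
        by_cases hr : r = s
        · subst hr; simp
        · simp [hr]
      have h2 : l.map (fun r => X (Function.update I s (J s) r) (J r)) =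
          l.map fun r => X (I r) (J r) := by
        refine List.map_congr_left fun r hr => ?_
        have : r ≠ s := fun h => hs (h ▸ hr)
        simp [this]
      have h3 : ∀ r, r ≠ s → I r = Function.update I s (J s) r := fun r hr => by simp [hr]
      simp only [h1, h2, inSlot, Matrix.of_apply, if_pos h3]
      simp
    · intro K _ hK
      rw [ih hl]
      simp only [inSlot, Matrix.of_apply]
      split_ifs with h1 h2
      · refine absurd (funext fun r => ?_) hK
        by_cases hr : r = s
        · subst hr
          simp [h2 r hs]
        · simp [hr, h1 r hr]
      all_goals simp
    · simp

theorem tensorPow_apply {n k : ℕ} {A : Type} [Ring A] (X : Matrix (Fin n) (Fin n) A)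
    (I J : Fin k → Fin n) :
    tensorPow k X I J = (List.ofFn fun s => X (I s) (J s)).prod := by
  rw [tensorPow, List.ofFn_eq_map, prod_map_inSlot_apply X _ (List.nodup_finRange k),
    List.ofFn_eq_map, if_pos (by simp)]

theorem trace_permMatrix_mul {n k : ℕ} {A : Type} [Ring A] [Algebra ℂ A]
    (X : Matrix (Fin n) (Fin n) A) (σ : Equiv.Perm (Fin k)) :
    ((permMatrix n σ).map (algebraMap ℂ A) * tensorPow k X).trace =
      ∑ I : Fin k → Fin n, (List.ofFn fun s => X (I (σ s)) (I s)).prod := by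
  rw [Matrix.trace]
  refine Finset.sum_congr rfl fun I _ => ?_
  have h : ∀ J : Fin k → Fin n, I = J ∘ σ.symm ↔ J = I ∘ σ := by
    intro J
    rw [Equiv.eq_comp_symm, eq_comm]
  simp [Matrix.mul_apply, permMatrix, h, apply_ite (algebraMap ℂ A), tensorPow_apply]

/-- The trace with a twisted symmetrizer. -/
theorem trace_symmetrizer_mul {n k : ℕ} {A : Type} [Ring A] [Algebra ℂ A] (θ : ℤˣ)
    (X : Matrix (Fin n) (Fin n) A) :
    (((1 / (k.factorial : ℂ)) •
      ∑ σ : Equiv.Perm (Fin k), ((permChar θ σ : ℤ) : ℂ) • permMatrix n σ).map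
        (algebraMap ℂ A) * tensorPow k X).trace = twistedSymm θ X k := by
  have h : ((1 / (k.factorial : ℂ)) •
      ∑ σ : Equiv.Perm (Fin k), ((permChar θ σ : ℤ) : ℂ) • permMatrix n σ).map
        (algebraMap ℂ A) = (1 / (k.factorial : ℂ)) • ∑ σ : Equiv.Perm (Fin k),
          permChar θ σ • (permMatrix n σ).map (algebraMap ℂ A) := by
    ext I J
    simp only [Matrix.map_apply, Matrix.smul_apply, Matrix.sum_apply, smul_eq_mul, map_mul,
      map_sum]
    rw [Algebra.smul_def]
    congr 1
    refine Finset.sum_congr rfl fun σ _ => ?_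
    rw [Units.smul_def, ← Int.cast_smul_eq_zsmul ℂ, Algebra.smul_def]
  rw [h, smul_mul_assoc, Matrix.trace_smul, twistedSymm, Finset.sum_mul, Matrix.trace_sum,
    principalSum]
  congr 1
  simp only [twistedDet]
  rw [Finset.sum_comm]
  refine Finset.sum_congr rfl fun σ _ => ?_
  rw [smul_mul_assoc, Matrix.trace_smul, trace_permMatrix_mul, Finset.smul_sum]

theorem twistedSymm_zero {n : ℕ} {A : Type} [Ring A] [Algebra ℂ A] (θ : ℤˣ)
    (X : Matrix (Fin n) (Fin n) A) : twistedSymm θ X 0 = 1 := by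
  simp [twistedSymm, principalSum, twistedDet]

theorem IsManin.twistedSymm_eq_sum {n : ℕ} {A : Type} [Ring A] [Algebra ℂ A] {θ : ℤˣ}
    {X : Matrix (Fin n) (Fin n) A} (hX : IsManin θ X) (k : ℕ) :
    twistedSymm θ X k = ∑ c : Composition k,
      (((θ : ℤ) : ℂ) ^ (k - c.length) / partialSumProd c) •
        (c.blocks.map fun i => (X ^ i).trace).prod := by
  refine eq_sum_composition _ (twistedSymm θ X) (fun i => (X ^ i).trace)
    (twistedSymm_zero θ X) (fun m => ?_) k
  rw [hX.newton]
  congr 1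
  refine Finset.sum_congr rfl fun j _ => ?_
  rw [Units.smul_def, ← Int.cast_smul_eq_zsmul ℂ]
  simp

/-! ### The operator matrices `T(u) τ` and `T(u) τ⁻¹` -/

theorem shift_comp_mulLeft {A : Type} [Ring A] [Algebra ℂ A] (c : ℂ) (f : PowerSeries A) :
    shift A c * LinearMap.mulLeft ℂ f = LinearMap.mulLeft ℂ (shift A c f) * shift A c := by
  ext1 g
  simp [shift_mul]

theorem mulLeft_mul_shift_mul {A : Type} [Ring A] [Algebra ℂ A] (c : ℂ) (f g : PowerSeries A) :
    LinearMap.mulLeft ℂ f * shift A c * (LinearMap.mulLeft ℂ g * shift A c) =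
      LinearMap.mulLeft ℂ (f * shift A c g) * (shift A c * shift A c) := by
  rw [LinearMap.mulLeft_mul, mul_assoc, ← mul_assoc (shift A c), shift_comp_mulLeft]
  rfl

theorem mulLeft_mul_add_smul {B : Type*} [Ring B] [Algebra ℂ B] (θ : ℤˣ) (f g : B)
    (S : Module.End ℂ B) :
    LinearMap.mulLeft ℂ f * S + θ • (LinearMap.mulLeft ℂ g * S) =
      LinearMap.mulLeft ℂ (f + θ • g) * S := by
  ext1 x
  rcases Int.units_eq_one_or θ with rfl | rfl <;> simp [add_mul]

theorem add_units_smul_eq {M : Type*} [AddCommGroup M] (θ : ℤˣ) (x y : M) :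
    x + θ • y = θ • (y + θ • x) := by
  rw [smul_add, smul_smul, Int.units_mul_self, one_smul, add_comm]

/-- Moving τ^θ to the right leaves the left side of `T_mul_shift`. Its right side is visibly
multiplied by `θ` when the columns `c` and `d` are exchanged. -/
theorem isManin_T_shift (n : ℕ) (θ : ℤˣ) :
    IsManin θ (Matrix.of fun i j =>
      LinearMap.mulLeft ℂ (T n i j) * shift (Yangian n) ((θ : ℤ) : ℂ) :
        Matrix (Fin n) (Fin n) (Op n)) := by
  intro a b c d
  simp only [Matrix.of_apply, mulLeft_mul_shift_mul]
  rw [mulLeft_mul_add_smul, mulLeft_mul_add_smul, T_mul_shift, T_mul_shift,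
    ← mulLeft_mul_add_smul, ← mulLeft_mul_add_smul]
  exact add_units_smul_eq (M := Op n) θ _ _

theorem isManin_TTau (n : ℕ) : IsManin 1 (TTau n) := by
  simpa [TTau, tau] using isManin_T_shift n 1

theorem isManin_TTauInv (n : ℕ) : IsManin (-1) (TTauInv n) := by
  simpa [TTauInv, tauInv] using isManin_T_shift n (-1)

theorem e_eq_twistedSymm (n k : ℕ) : e n k = twistedSymm (-1) (TTauInv n) k := by
  rw [← trace_symmetrizer_mul]
  simp only [e, antisymmetrizer, permChar_neg_one]

theorem h_eq_twistedSymm (n k : ℕ) : h n k = twistedSymm 1 (TTau n) k := by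
  rw [← trace_symmetrizer_mul]
  simp only [h, symmetrizer, permChar_one, Units.val_one, Int.cast_one, one_smul]

end YangianGL

end

theorem mainTheorem2 (n k : ℕ) :
    YangianGL.e n k =
        ∑ c : Composition k,
          ((-1 : ℂ) ^ (k - c.length) / YangianGL.partialSumProd c) •
            (c.blocks.map (YangianGL.pMinus n)).prod ∧
      YangianGL.h n k =
        ∑ c : Composition k,
          (1 / YangianGL.partialSumProd c) • (c.blocks.map (YangianGL.pPlus n)).prod := by
  constructor
  · rw [YangianGL.e_eq_twistedSymm, (YangianGL.isManin_TTauInv n).twistedSymm_eq_sum]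
    simp only [Units.val_neg, Units.val_one, Int.cast_neg, Int.cast_one]
    rfl
  · rw [YangianGL.h_eq_twistedSymm, (YangianGL.isManin_TTau n).twistedSymm_eq_sum]
    simp only [Units.val_one, Int.cast_one, one_pow]
    rfl
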